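/- Let $r\ge 1$ and $n\ge 3$ be integers and let $Q$ be a polynomial of degree at most $2$ in $n$ variables over $\mathbb{Z}_{2^r}=\mathbb{Z}/2^r\mathbb{Z}$; let $z$ be one of the variables. For integers $k,c$ let $\#k_{Q,\,z=c}$ denote the number of points of $(\mathbb{Z}_{2^r})^n$ at which $Q$ takes the value $k \bmod 2^r$ and whose $z$-coordinate is $c \bmod 2^r$. For all integers $0\le q,v\le r$ and all integers $k,w,g,l$: (a) $\displaystyle\sum_{j=0}^{2^v-1} \#k_{Q,\,z=l+g2^{r-v}j}$ is a multiple of $2^{\left\lceil \frac{r(n-1)+\min(2v,r)}{2}\right\rceil-1}$; (b) $\displaystyle\sum_{i=0}^{2^q-1}\sum_{j=0}^{2^v-1} \#(k+w2^{r-q}i)_{Q,\,z=l+g2^{r-v}j}$ is a multiple of $2^{\left\lceil \frac{r(n-1)+\min(2v,r)}{2}\right\rceil+q-1}$; (c) if $q\le v$, then $\displaystyle\sum_{j=0}^{2^v-1} \#(k+w2^{r-q}j)_{Q,\,z=l+g2^{r-v}j}$ is a multiple of $2^{\left\lceil \frac{r(n-1)+\min(2v,r)}{2}\right\rceil-1}$.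 -/

import Mathlib

/-- `#k_{Q, z = c}` over `ℤ / 2^r`: the number of points of `(ℤ / 2^r)^n` at which the polynomial
`Q` takes the value `k` and whose coordinate with index `z` equals `c`. The integers `k` and `c`
are read modulo `2^r`. -/
noncomputable def solCount {r n : ℕ} (Q : MvPolynomial (Fin n) (ZMod (2 ^ r))) (k : ℤ)
    (z : Fin n) (c : ℤ) : ℕ :=
  Set.ncard {p : Fin n → ZMod (2 ^ r) |
    MvPolynomial.eval p Q = (k : ZMod (2 ^ r)) ∧ p z = (c : ZMod (2 ^ r))}

/-- The exponent `⌈(r (n - 1) + min (2 v) r) / 2⌉`. -/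
def divExp (r n v : ℕ) : ℕ := ⌈((r * (n - 1) + min (2 * v) r : ℚ) / 2)⌉₊

/-! Substituting `l + g 2^(r-v) z` for `z` in `Q` and subtracting a multiple of `z` gives a
quadratic function `P` on the whole module, and each sum over `j` in (a) and (c) becomes a number of
solutions of `P = k`, up to the factor `2^(r-v)` (`card_restricted_eq`). It remains to count the
solutions of `P ≡ k` modulo `2^(r-σ)`, for every `σ`.

Two residues that differ by half the modulus have counts whose sum is the count one level coarser.
Their difference is a coefficient of the Gauss sum `∑ ζ^(2^σ P)` in the power basis of `ℤ[ζ]`.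
Descending induction on `σ` therefore needs only the divisibility of these sums by powers of 2
(`two_pow_dvd_levelCount`); recovering one count from sum and difference halves, whence the `-1` in
the exponents.

A Gauss sum times its conjugate is 0 or the order of the group times that of the radical of the
polar form. Since 2 is totally ramified in `ℤ[ζ]`, both factors have the same valuation, so `2^e`
divides the sum once `2^(2e)` divides the product of the orders of the group and of the kernel
(`two_pow_dvd_sum_char`).

The kernel is bounded below by rescaling coordinates. When the ceiling rounds up, one more factor 2
is needed; for `σ = 0` it comes from the fact that alternating forms over `𝔽₂` in odd dimension are
degenerate (`two_pow_dvd_card_mul_card_ker`). -/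

/-- The ring `ℤ[ζ]` with `ζ` a primitive root of unity of order `2 ^ (a + 1)`. -/
abbrev TwoPowCyclotomic (a : ℕ) : Type :=
  AdjoinRoot (Polynomial.X ^ (2 ^ a) + 1 : Polynomial ℤ)

/-! ### Arithmetic of `ℤ[ζ]` at the prime above 2. -/

namespace TwoPowCyclotomic

open Polynomial

variable {a : ℕ}

theorem prime_X_pow_add_one (a : ℕ) : Prime (X ^ (2 ^ a) + 1 : ℤ[X]) := by
  have h : (X ^ (2 ^ a) + 1 : ℤ[X]) = cyclotomic (2 ^ (a + 1)) ℤ := by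
    rw [cyclotomic_prime_pow_eq_geom_sum Nat.prime_two]
    simp [Finset.sum_range_succ, add_comm]
  rw [h]
  exact (cyclotomic.irreducible (by positivity)).prime

instance : IsDomain (TwoPowCyclotomic a) :=
  AdjoinRoot.isDomain_of_prime (prime_X_pow_add_one a)

/-- The distinguished root of unity. -/
noncomputable def zeta (a : ℕ) : TwoPowCyclotomic a := AdjoinRoot.root _

theorem zeta_pow_half (a : ℕ) : zeta a ^ (2 ^ a) = -1 := by
  have h : AdjoinRoot.mk (X ^ (2 ^ a) + 1 : ℤ[X]) (X ^ (2 ^ a) + 1) = 0 := AdjoinRoot.mk_self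
  rw [map_add, map_pow, AdjoinRoot.mk_X, map_one] at h
  exact eq_neg_of_add_eq_zero_left h

theorem zeta_pow_order (a : ℕ) : zeta a ^ (2 ^ (a + 1)) = 1 := by
  rw [pow_succ, pow_mul, zeta_pow_half]; norm_num

/-- Reduction modulo the prime above `2`. -/
noncomputable def residue (a : ℕ) : TwoPowCyclotomic a →+* ZMod 2 :=
  AdjoinRoot.lift (Int.castRingHom (ZMod 2)) 1 (by
    simp only [eval₂_add, eval₂_pow, eval₂_X, eval₂_one, one_pow]; decide)

theorem residue_zeta : residue a (zeta a) = 1 := AdjoinRoot.lift_root _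

theorem dvd_two : zeta a - 1 ∣ 2 := by
  have h := sub_dvd_pow_sub_pow (zeta a) 1 (2 ^ a)
  rw [zeta_pow_half, one_pow] at h
  have h2 : (-1 - 1 : TwoPowCyclotomic a) = -2 := by ring
  rw [h2] at h
  exact (dvd_neg).1 h

/-- Modulo `ζ - 1` a polynomial in `ζ` equals its value at 1, and `ζ - 1` divides 2. Hence `ζ - 1`
generates the kernel of a map to a field, which makes it prime. -/
theorem residue_eq_zero_iff (x : TwoPowCyclotomic a) : residue a x = 0 ↔ zeta a - 1 ∣ x := by
  constructor
  · intro hx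
    obtain ⟨f, rfl⟩ := AdjoinRoot.mk_surjective x
    have h1 : zeta a - 1 ∣ AdjoinRoot.mk _ (f - C (f.eval 1)) := by
      have h : (X - C 1 : ℤ[X]) ∣ f - C (f.eval 1) := by
        rw [dvd_iff_isRoot]; simp
      have := map_dvd (AdjoinRoot.mk (X ^ (2 ^ a) + 1 : ℤ[X])) h
      rwa [map_sub, AdjoinRoot.mk_X, C_1, map_one] at this
    have h2 : ((f.eval 1 : ℤ) : ZMod 2) = 0 := by
      rw [← hx]
      obtain ⟨c, hc⟩ := h1
      have := congrArg (residue a) hc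
      rw [map_mul, map_sub (residue a), residue_zeta, map_one, sub_self, zero_mul, map_sub,
        map_sub, sub_eq_zero] at this
      rw [this]
      simp
    rw [ZMod.intCast_zmod_eq_zero_iff_dvd] at h2
    obtain ⟨d, hd⟩ := h2
    have h3 : AdjoinRoot.mk (X ^ (2 ^ a) + 1 : ℤ[X]) f
        = AdjoinRoot.mk _ (f - C (f.eval 1)) + 2 * (d : TwoPowCyclotomic a) := by
      have h4 : AdjoinRoot.mk (X ^ (2 ^ a) + 1 : ℤ[X]) 2 = 2 := map_ofNat _ 2
      rw [map_sub, hd]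
      simp [h4]
    rw [h3]
    exact dvd_add h1 (dvd_two.mul_right _)
  · rintro ⟨c, rfl⟩
    rw [map_mul, map_sub, residue_zeta, map_one, sub_self, zero_mul]

theorem two_dvd_pow : (2 : TwoPowCyclotomic a) ∣ (zeta a - 1) ^ (2 ^ a) := by
  obtain ⟨c, hc⟩ := exists_add_pow_prime_pow_eq Nat.prime_two (zeta a) (-1) a
  rw [sub_eq_add_neg, hc, zeta_pow_half]
  refine dvd_add ?_ (by simp [mul_assoc])
  rcases neg_one_pow_eq_or (TwoPowCyclotomic a) (2 ^ a) with h | h <;> rw [h]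
  · simp
  · exact ⟨-1, by ring⟩

theorem two_ne_zero' : (2 : TwoPowCyclotomic a) ≠ 0 := by
  intro h
  have h' : AdjoinRoot.mk (X ^ (2 ^ a) + 1 : ℤ[X]) (C 2) = 0 := by
    rw [← h]
    exact map_ofNat _ 2
  rw [AdjoinRoot.mk_eq_zero] at h'
  have hm : (X ^ (2 ^ a) + 1 : ℤ[X]).Monic := monic_X_pow_add_C 1 (by positivity)
  have hd := hm.not_dvd_of_natDegree_lt (p := (X ^ (2 ^ a) + 1 : ℤ[X])) (q := C 2) (by simp) (by
    have : (X ^ (2 ^ a) + 1 : ℤ[X]).natDegree = 2 ^ a := natDegree_X_pow_add_C (r := 1)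
    rw [natDegree_C, this]; positivity)
  exact hd h'

theorem prime_zeta_sub_one : Prime (zeta a - 1) := by
  refine ⟨?_, ?_, ?_⟩
  · intro h
    have := dvd_two (a := a)
    rw [h, zero_dvd_iff] at this
    exact two_ne_zero' this
  · intro h
    have := h.map (residue a)
    rw [map_sub, residue_zeta, map_one, sub_self] at this
    exact not_isUnit_zero this
  · intro x y h
    rw [← residue_eq_zero_iff, map_mul, mul_eq_zero] at h
    simpa only [residue_eq_zero_iff] using h

/-- Complex conjugation. -/
noncomputable def conj (a : ℕ) : TwoPowCyclotomic a →+* TwoPowCyclotomic a :=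
  AdjoinRoot.lift (Int.castRingHom _) (zeta a ^ (2 ^ (a + 1) - 1)) (by
    simp only [eval₂_add, eval₂_pow, eval₂_X, eval₂_one]
    have h : zeta a ^ (2 ^ (a + 1) - 1) * zeta a = 1 := by
      rw [← pow_succ, Nat.sub_add_cancel Nat.one_le_two_pow, zeta_pow_order]
    have h2 : ((zeta a ^ (2 ^ (a + 1) - 1)) ^ 2 ^ a) * zeta a ^ 2 ^ a = 1 := by
      rw [← mul_pow, h, one_pow]
    rw [zeta_pow_half] at h2
    linear_combination -h2)

theorem conj_zeta_mul : conj a (zeta a) * zeta a = 1 := by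
  have : conj a (zeta a) = zeta a ^ (2 ^ (a + 1) - 1) := AdjoinRoot.lift_root _
  rw [this, ← pow_succ, Nat.sub_add_cancel Nat.one_le_two_pow, zeta_pow_order]

theorem pow_dvd_conj {i : ℕ} {x : TwoPowCyclotomic a} (h : (zeta a - 1) ^ i ∣ x) :
    (zeta a - 1) ^ i ∣ conj a x := by
  have h1 := map_dvd (conj a) h
  rw [map_pow] at h1
  refine (pow_dvd_pow_of_dvd ?_ i).trans h1
  refine ⟨-conj a (zeta a), ?_⟩
  rw [map_sub, map_one]
  linear_combination conj_zeta_mul (a := a)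

/-- 2 is associated to a power of the prime `ζ - 1`, and conjugation preserves divisibility by
powers of that prime. If `x` had too small a valuation, so would `y`, and hence the product. -/
theorem two_pow_dvd_of_mul_conj {e : ℕ} {x y : TwoPowCyclotomic a} (hyx : conj a y = x) (h : (2 : TwoPowCyclotomic a) ^ (2 * e) ∣ x * y) :
    (2 : TwoPowCyclotomic a) ^ e ∣ x := by
  obtain ⟨i, -, hi⟩ := (dvd_prime_pow prime_zeta_sub_one _).1 (two_dvd_pow (a := a))
  have hk (k : ℕ) : Associated ((2 : TwoPowCyclotomic a) ^ k) ((zeta a - 1) ^ (i * k)) := by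
    rw [pow_mul]; exact hi.pow_pow
  rw [(hk _).dvd_iff_dvd_left] at h ⊢
  by_contra hx
  have hy : ¬ (zeta a - 1) ^ (i * e) ∣ y := fun hy => hx (hyx ▸ pow_dvd_conj hy)
  rw [pow_dvd_iff_le_emultiplicity, not_le] at hx hy
  rw [pow_dvd_iff_le_emultiplicity, emultiplicity_mul prime_zeta_sub_one] at h
  have h3 := ENat.add_lt_add hx hy
  refine absurd h (not_le.2 (h3.trans_le ?_))
  norm_cast
  apply le_of_eq; ring

/-- The additive character `t ↦ ζ ^ t` of `ℤ / 2 ^ (a + 1)`. -/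
noncomputable def char (a : ℕ) : AddChar (ZMod (2 ^ (a + 1))) (TwoPowCyclotomic a) :=
  AddChar.zmodChar _ (zeta_pow_order a)

theorem conj_char (t : ZMod (2 ^ (a + 1))) : conj a (char a t) = char a (-t) := by
  have h1 : conj a (char a t) * char a t = 1 := by
    rw [char, AddChar.zmodChar_apply, map_pow, ← mul_pow, conj_zeta_mul, one_pow]
  have h2 : char a (-t) * char a t = 1 := by
    rw [← AddChar.map_add_eq_mul, neg_add_cancel, AddChar.map_zero_eq_one]
  have h3 : char a t ≠ 0 := fun h => by simp [h] at h1
  exact mul_right_cancel₀ h3 (h1.trans h2.symm)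

/-- The linear form on `ℤ[X]` that reads off the coefficient of `ζ ^ k`. -/
noncomputable def coeffForm (k : ZMod (2 ^ (a + 1))) : ℤ[X] →ₗ[ℤ] ℤ :=
  lsum fun m => ((if (m : ZMod (2 ^ (a + 1))) = k then 1 else 0) -
    (if (m : ZMod (2 ^ (a + 1))) = k + 2 ^ a then 1 else 0) : ℤ) • LinearMap.id

theorem coeffForm_monomial (k : ZMod (2 ^ (a + 1))) (m : ℕ) (c : ℤ) :
    coeffForm k (monomial m c) = ((if (m : ZMod (2 ^ (a + 1))) = k then 1 else 0) -
      (if (m : ZMod (2 ^ (a + 1))) = k + 2 ^ a then 1 else 0)) * c := by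
  rw [coeffForm, lsum_apply, sum_monomial_index _ _ (by simp), LinearMap.smul_apply, LinearMap.id_apply,
    smul_eq_mul]

theorem half_add_half (a : ℕ) : (2 ^ a + 2 ^ a : ZMod (2 ^ (a + 1))) = 0 := by
  have h : ((2 ^ (a + 1) : ℕ) : ZMod (2 ^ (a + 1))) = 0 := ZMod.natCast_self _
  push_cast at h
  rw [← h]; ring

/-- Multiplication by `X^(2^a)` swaps the exponent classes `k` and `k + 2^a`, which carry opposite
signs. So the form descends to `ℤ[ζ]`. -/
theorem coeffForm_mul (k : ZMod (2 ^ (a + 1))) (f : ℤ[X]) :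
    coeffForm k ((X ^ (2 ^ a) + 1) * f) = 0 := by
  induction f using Polynomial.induction_on' with
  | add p q hp hq => rw [mul_add, map_add, hp, hq, add_zero]
  | monomial m c =>
    have h1 : (X ^ (2 ^ a) + 1) * monomial m c = monomial (m + 2 ^ a) c + monomial m c := by
      rw [add_mul, one_mul, X_pow_mul_monomial]
    rw [h1, map_add, coeffForm_monomial, coeffForm_monomial]
    have h2 : (((m + 2 ^ a : ℕ) : ZMod (2 ^ (a + 1))) = k) ↔
        ((m : ZMod (2 ^ (a + 1))) = k + 2 ^ a) := by
      push_cast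
      constructor <;> intro h
      · linear_combination h - half_add_half a
      · linear_combination h + half_add_half a
    have h3 : (((m + 2 ^ a : ℕ) : ZMod (2 ^ (a + 1))) = k + 2 ^ a) ↔
        ((m : ZMod (2 ^ (a + 1))) = k) := by
      push_cast
      exact add_left_inj _
    simp only [h2, h3]
    ring

theorem dvd_card_sub_card {V : Type*} [Fintype V] (P : V → ZMod (2 ^ (a + 1))) (e : ℕ)
    (h : (2 : TwoPowCyclotomic a) ^ e ∣ ∑ x, char a (P x)) (k : ZMod (2 ^ (a + 1))) :
    (2 : ℤ) ^ e ∣ ((Finset.univ.filter fun x => P x = k).card : ℤ) -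
      ((Finset.univ.filter fun x => P x = k + 2 ^ a).card : ℤ) := by
  have h1 : ∑ x, char a (P x) =
      AdjoinRoot.mk (X ^ (2 ^ a) + 1 : ℤ[X]) (∑ x, monomial (P x).val 1) := by
    rw [map_sum]
    refine Finset.sum_congr rfl fun x _ => ?_
    rw [char, AddChar.zmodChar_apply, ← X_pow_eq_monomial, map_pow, AdjoinRoot.mk_X, zeta]
  obtain ⟨g, hg⟩ := h
  obtain ⟨g, rfl⟩ := AdjoinRoot.mk_surjective g
  have h2 : AdjoinRoot.mk (X ^ (2 ^ a) + 1 : ℤ[X]) (∑ x, monomial (P x).val 1) =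
      AdjoinRoot.mk _ ((2 : ℤ) ^ e • g) := by
    have h4 : AdjoinRoot.mk (X ^ (2 ^ a) + 1 : ℤ[X]) 2 = 2 := map_ofNat _ 2
    rw [← h1, hg, zsmul_eq_mul, map_mul]
    simp [h4]
  rw [AdjoinRoot.mk_eq_mk] at h2
  obtain ⟨d, hd⟩ := h2
  have h3 := congrArg (coeffForm k) (sub_eq_iff_eq_add.1 hd)
  rw [map_add, coeffForm_mul, zero_add, map_smul, map_sum] at h3
  simp only [coeffForm_monomial, ZMod.natCast_zmod_val, mul_one] at h3
  rw [Finset.sum_sub_distrib, Finset.sum_boole, Finset.sum_boole] at h3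
  rw [h3]
  exact Dvd.intro _ rfl

end TwoPowCyclotomic

/-! ### Gauss sums of quadratic functions. -/

namespace TwoPowCyclotomic

variable {a : ℕ} {V : Type*} [AddCommGroup V]

/-- The elements whose polar form with everything has trivial character value. -/
def radical (B : V →+ V →+ ZMod (2 ^ (a + 1))) : AddSubgroup V where
  carrier := {h | ∀ x, char a (B h x) = 1}
  zero_mem' := by simp
  add_mem' := by
    intro g h hg hh x
    rw [map_add, AddMonoidHom.add_apply, AddChar.map_add_eq_mul, hg, hh, one_mul]
  neg_mem' := by
    intro g hg x
    have h1 : char a (B (-g) x) * char a (B g x) = 1 := by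
      rw [← AddChar.map_add_eq_mul, map_neg, AddMonoidHom.neg_apply, neg_add_cancel,
        AddChar.map_zero_eq_one]
    rwa [hg, mul_one] at h1

theorem mem_radical {B : V →+ V →+ ZMod (2 ^ (a + 1))} {h : V} :
    h ∈ radical B ↔ ∀ x, char a (B h x) = 1 := Iff.rfl

/-- On the radical of the polar form the exponential of a quadratic function is a character. -/
noncomputable def radicalChar (P : V → ZMod (2 ^ (a + 1))) (B : V →+ V →+ ZMod (2 ^ (a + 1)))
    (hP : ∀ x h, P (x + h) + P 0 = P x + P h + B h x) :
    AddChar (radical B) (TwoPowCyclotomic a) where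
  toFun h := char a (P h - P 0)
  map_zero_eq_one' := by simp
  map_add_eq_mul' := by
    intro g h
    have h1 : P ((g + h : radical B) : V) - P 0 = (P g - P 0) + (P h - P 0) + B h g := by
      rw [AddSubgroup.coe_add]
      linear_combination hP g h
    rw [h1, AddChar.map_add_eq_mul, mem_radical.1 h.2, mul_one, AddChar.map_add_eq_mul]

variable [Fintype V]

open scoped Classical in
theorem sum_char_polar (B : V →+ V →+ ZMod (2 ^ (a + 1))) (h : V) :
    ∑ x, char a (B h x) = if h ∈ radical B then (Fintype.card V : TwoPowCyclotomic a) else 0 := by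
  have h1 := AddChar.sum_eq_ite ((char a).compAddMonoidHom (B h))
  have h2 : (char a).compAddMonoidHom (B h) = 0 ↔ h ∈ radical B := by
    rw [AddChar.eq_zero_iff]; rfl
  simpa only [h2, AddChar.compAddMonoidHom_apply] using h1

-- Squaring the sum linearizes it: `P (x + h) - P x` is additive in `x` up to a constant, so summing
-- over `x` leaves only the `h` in the radical.
open scoped Classical in
theorem sum_char_mul_conj (P : V → ZMod (2 ^ (a + 1))) (B : V →+ V →+ ZMod (2 ^ (a + 1)))
    (hP : ∀ x h, P (x + h) + P 0 = P x + P h + B h x) :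
    (∑ x, char a (P x)) * conj a (∑ x, char a (P x)) =
      Fintype.card V * ∑ h : radical B, radicalChar P B hP h := by
  calc (∑ x, char a (P x)) * conj a (∑ x, char a (P x))
      = ∑ x, ∑ h, char a (P h - P 0) * char a (B h x) := by
        rw [mul_comm, map_sum, Finset.sum_mul]
        refine Finset.sum_congr rfl fun x _ => ?_
        -- The second summation variable becomes `x + h`.
        rw [← Equiv.sum_comp (Equiv.addLeft x), Finset.mul_sum]
        refine Finset.sum_congr rfl fun h _ => ?_
        rw [conj_char, ← AddChar.map_add_eq_mul, ← AddChar.map_add_eq_mul]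
        congr 1
        rw [Equiv.coe_addLeft]
        linear_combination hP x h
    _ = ∑ h, if h ∈ radical B then
          (Fintype.card V : TwoPowCyclotomic a) * char a (P h - P 0) else 0 := by
        rw [Finset.sum_comm]
        refine Finset.sum_congr rfl fun h _ => ?_
        rw [← Finset.mul_sum, sum_char_polar]
        split_ifs <;> ring
    _ = _ := by
        rw [← Finset.sum_filter, ← Finset.mul_sum]
        congr 1
        exact Finset.sum_subtype (p := fun h => h ∈ radical B) _ (by simp)
          (fun h => char a (P h - P 0))

/-- A Gauss sum of a quadratic function on a finite group is divisible by the square root of the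
product of the orders of the group and of the radical of the polar form. -/
theorem two_pow_dvd_sum_char (P : V → ZMod (2 ^ (a + 1))) (B : V →+ V →+ ZMod (2 ^ (a + 1)))
    (hP : ∀ x h, P (x + h) + P 0 = P x + P h + B h x) (e : ℕ)
    (he : 2 ^ (2 * e) ∣ Nat.card V * Nat.card B.ker) :
    (2 : TwoPowCyclotomic a) ^ e ∣ ∑ x, char a (P x) := by
  classical
  refine two_pow_dvd_of_mul_conj (y := conj a (∑ x, char a (P x))) ?_ ?_
  · simp only [map_sum, conj_char, neg_neg]
  · have h1 : B.ker ≤ radical B := by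
      intro h hh x
      rw [AddMonoidHom.mem_ker] at hh
      rw [hh, AddMonoidHom.zero_apply, AddChar.map_zero_eq_one]
    have h2 := Nat.cast_dvd_cast (α := TwoPowCyclotomic a)
      (he.trans (mul_dvd_mul_left _ (AddSubgroup.card_dvd_of_le h1)))
    push_cast at h2
    rw [sum_char_mul_conj P B hP, AddChar.sum_eq_ite, ← Nat.card_eq_fintype_card,
      ← Nat.card_eq_fintype_card]
    split_ifs
    · exact h2
    · simp

end TwoPowCyclotomic

/-! ### Orders of preimages of subgroups. -/

section CardComap

variable {G G' : Type*} [AddCommGroup G] [AddCommGroup G']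

theorem AddSubgroup.card_inf_mul_relIndex (H K : AddSubgroup G) :
    Nat.card (H ⊓ K : AddSubgroup G) * H.relIndex K = Nat.card K := by
  rw [← AddSubgroup.inf_relIndex_right, ← AddSubgroup.relIndex_bot_left,
    ← AddSubgroup.relIndex_bot_left]
  exact AddSubgroup.relIndex_mul_relIndex _ _ _ bot_le inf_le_right

theorem AddSubgroup.relIndex_pos_of_finite [Finite G] (H K : AddSubgroup G) :
    0 < H.relIndex K :=
  Nat.pos_of_ne_zero fun h => by
    have h1 := AddSubgroup.card_inf_mul_relIndex H K
    rw [h, mul_zero] at h1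
    exact Nat.card_pos.ne h1

/-- The index of the preimage is the index of `S` relative to the range of `f`, which is at most its
index in the larger group `H`. -/
theorem AddSubgroup.card_mul_card_le_card_comap [Finite G] [Finite G'] (f : G →+ G')
    {S H : AddSubgroup G'} (hS : S ≤ H) (hf : f.range ≤ H) :
    Nat.card G * Nat.card S ≤ Nat.card H * Nat.card (S.comap f) := by
  rw [← AddSubgroup.card_mul_index (S.comap f), AddSubgroup.index_comap,
    ← AddSubgroup.card_inf_mul_relIndex S H, inf_eq_left.2 hS]
  have h : S.relIndex f.range ≤ S.relIndex H :=
    AddSubgroup.relIndex_le_of_le_right hf (AddSubgroup.relIndex_pos_of_finite S H).ne'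
  calc _ = (Nat.card S * Nat.card (S.comap f)) * S.relIndex f.range := by ring
    _ ≤ (Nat.card S * Nat.card (S.comap f)) * S.relIndex H := by gcongr
    _ = _ := by ring

theorem AddSubgroup.card_comap_le [Finite G] [Finite G'] (f : G →+ G') (T : AddSubgroup G') :
    Nat.card (T.comap f) ≤ Nat.card T * Nat.card f.ker := by
  have h1 : Nat.card (T.comap f) * T.relIndex f.range = Nat.card G := by
    rw [← AddSubgroup.index_comap, AddSubgroup.card_mul_index]
  have h2 : Nat.card f.ker * (Nat.card (T ⊓ f.range : AddSubgroup G') * T.relIndex f.range) =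
      Nat.card G := by
    rw [AddSubgroup.card_inf_mul_relIndex, ← AddSubgroup.index_ker, AddSubgroup.card_mul_index]
  have h3 : Nat.card (T ⊓ f.range : AddSubgroup G') ≤ Nat.card T :=
    Nat.card_le_card_of_injective _ (AddSubgroup.inclusion_injective inf_le_left)
  have h4 : 0 < T.relIndex f.range := AddSubgroup.relIndex_pos_of_finite _ _
  refine Nat.le_of_mul_le_mul_right (c := T.relIndex f.range) ?_ h4
  rw [h1, ← h2, ← mul_assoc, mul_comm (Nat.card f.ker)]
  gcongr

end CardComap

/-- Such a matrix lifts to a skew-symmetric integer matrix of odd size, whose determinant is its own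
negative. -/
theorem Matrix.det_eq_zero_of_odd_card {κ : Type*} [Fintype κ] [DecidableEq κ]
    (hκ : Odd (Fintype.card κ)) (A : Matrix κ κ (ZMod 2)) (hA : A.transpose = A)
    (hd : ∀ i, A i i = 0) : A.det = 0 := by
  let e := Fintype.equivFin κ
  let C : Matrix κ κ ℤ := Matrix.of fun i j =>
    if e i < e j then ((A i j).val : ℤ) else if e j < e i then -((A i j).val : ℤ) else 0
  have hC : C.transpose = -C := by
    ext i j
    have h : A j i = A i j := congrFun (congrFun hA i) j
    simp only [C, Matrix.of_apply, Matrix.transpose_apply, Matrix.neg_apply, h]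
    split_ifs with h1 h2 <;> omega
  have h1 : C.det = 0 := by
    have h2 : C.det = -C.det := by
      conv_lhs => rw [← Matrix.det_transpose, hC, Matrix.det_neg, hκ.neg_one_pow]
      ring
    omega
  have h3 : A = C.map (Int.castRingHom (ZMod 2)) := by
    ext i j
    simp only [C, Matrix.of_apply, Matrix.map_apply]
    split_ifs with h4 h5
    · simp
    · simp [ZMod.neg_eq_self_mod_two]
    · have : i = j := e.injective (le_antisymm (not_lt.1 h5) (not_lt.1 h4))
      rw [this, hd]; simp
  rw [h3, ← RingHom.mapMatrix_apply, ← RingHom.map_det, h1, map_zero]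

/-! ### Diagonal scalings and kernels of polar forms. -/

section Scaling

variable {r : ℕ} {ι : Type*}

/-- Multiplication of the `i`-th coordinate by `2 ^ c i`. -/
def coordScale (r : ℕ) (c : ι → ℕ) : (ι → ZMod (2 ^ r)) →+ (ι → ZMod (2 ^ r)) where
  toFun x i := 2 ^ c i * x i
  map_zero' := by ext i; simp
  map_add' x y := by ext i; simp [mul_add]

@[simp]
theorem coordScale_apply (c : ι → ℕ) (x : ι → ZMod (2 ^ r)) (i : ι) :
    coordScale r c x i = 2 ^ c i * x i := rfl

theorem card_ker_coordScale [Fintype ι] (c : ι → ℕ) :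
    Nat.card (coordScale r c).ker = 2 ^ ∑ i, min r (c i) := by
  have e : (coordScale r c).ker ≃
      ∀ i, (nsmulAddMonoidHom (2 ^ c i) : ZMod (2 ^ r) →+ ZMod (2 ^ r)).ker :=
    { toFun := fun x i => ⟨x.1 i, by
        have := congrFun (AddMonoidHom.mem_ker.1 x.2) i
        simpa [AddMonoidHom.mem_ker] using this⟩
      invFun := fun x => ⟨fun i => (x i).1, by
        rw [AddMonoidHom.mem_ker]
        ext i
        have := AddMonoidHom.mem_ker.1 (x i).2
        simpa using this⟩
      left_inv := fun x => rfl
      right_inv := fun x => rfl }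
  rw [Nat.card_congr e, Nat.card_pi, ← Finset.prod_pow_eq_pow_sum]
  refine Finset.prod_congr rfl fun i _ => ?_
  rw [IsAddCyclic.card_nsmulAddMonoidHom_ker, Nat.card_zmod]
  rcases le_total r (c i) with h | h
  · rw [min_eq_left h, Nat.gcd_eq_left (pow_dvd_pow 2 h)]
  · rw [min_eq_right h, Nat.gcd_eq_right (pow_dvd_pow 2 h)]

end Scaling

section PolarForm

variable {r : ℕ} {ι : Type*} [Fintype ι]

/-- The bilinear form of a matrix, as a biadditive map. -/
def polarForm (M : Matrix ι ι (ZMod (2 ^ r))) :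
    (ι → ZMod (2 ^ r)) →+ (ι → ZMod (2 ^ r)) →+ ZMod (2 ^ r) where
  toFun h :=
    { toFun := fun x => x ⬝ᵥ M.mulVec h
      map_zero' := zero_dotProduct _
      map_add' := fun x y => add_dotProduct _ _ _ }
  map_zero' := by ext x; simp
  map_add' g h := by ext x; simp [Matrix.mulVec_add]

theorem polarForm_apply (M : Matrix ι ι (ZMod (2 ^ r))) (h x : ι → ZMod (2 ^ r)) :
    polarForm M h x = x ⬝ᵥ M.mulVec h := rfl

theorem mem_ker_polarForm [DecidableEq ι] {M : Matrix ι ι (ZMod (2 ^ r))}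
    {h : ι → ZMod (2 ^ r)} (hh : M.mulVec h = 0) : h ∈ (polarForm M).ker := by
  rw [AddMonoidHom.mem_ker]
  refine DFunLike.ext _ _ fun x => ?_
  rw [polarForm_apply, hh, dotProduct_zero, AddMonoidHom.zero_apply]

variable [DecidableEq ι]

/-- Vanishing of a nonzero linear form over `𝔽₂` halves the number of vectors. -/
theorem exists_index_two (hr : 1 ≤ r) (u : ι → ZMod 2) (hu : u ≠ 0) :
    ∃ H : AddSubgroup (ι → ZMod (2 ^ r)), 2 * Nat.card H = Nat.card (ι → ZMod (2 ^ r)) ∧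
      ∀ x, x ∈ H ↔ ∑ i, u i * (ZMod.castHom (dvd_pow_self 2 (by omega)) (ZMod 2) (x i)) = 0 := by
  let φ : (ι → ZMod (2 ^ r)) →+ ZMod 2 :=
    { toFun := fun x => ∑ i, u i * (ZMod.castHom (dvd_pow_self 2 (by omega)) (ZMod 2) (x i))
      map_zero' := by simp
      map_add' := fun x y => by
        simp only [Pi.add_apply, map_add, mul_add, Finset.sum_add_distrib] }
  refine ⟨φ.ker, ?_, fun x => AddMonoidHom.mem_ker⟩
  have hs : Function.Surjective φ := by
    obtain ⟨i, hi⟩ := Function.ne_iff.1 hu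
    have hi1 : u i = 1 := by
      have : ∀ t : ZMod 2, t ≠ 0 → t = 1 := by decide
      exact this _ hi
    intro t
    obtain ⟨s, hs⟩ := ZMod.castHom_surjective (dvd_pow_self 2 (show r ≠ 0 by omega)) t
    refine ⟨Pi.single i s, ?_⟩
    change ∑ j, _ = t
    rw [Finset.sum_eq_single i]
    · rw [Pi.single_eq_same, hi1, one_mul, hs]
    · intro j _ hj
      rw [Pi.single_eq_of_ne hj, map_zero, mul_zero]
    · simp
  have h := AddSubgroup.card_mul_index φ.ker
  rw [AddSubgroup.index_ker, AddMonoidHom.range_eq_top.2 hs, AddSubgroup.card_top,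
    Nat.card_zmod] at h
  omega

variable (N : Matrix ι ι (ZMod (2 ^ r))) (z : ι)

/-- The exponent vector with value `β` at `z` and `μ` elsewhere. -/
def pointExp (z : ι) (μ β : ℕ) : ι → ℕ := fun i => if i = z then β else μ

/-- The matrix `2 ^ σ D N D`, where `D` multiplies the coordinate `z` by `2 ^ β`. -/
def scaledMatrix (σ β : ℕ) : Matrix ι ι (ZMod (2 ^ r)) :=
  fun i j => 2 ^ σ * (2 ^ pointExp z 0 β i * N i j * 2 ^ pointExp z 0 β j)

/-- Scaling by `2^μ` off `z` balances the two kinds of columns: a common factor `2^(σ+μ)` comes out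
of every row, and row `z` carries `2^(μ+δ)` more. -/
theorem scaledMatrix_mulVec_coordScale (σ μ δ : ℕ) (y : ι → ZMod (2 ^ r)) :
    (scaledMatrix N z σ (μ + δ)).mulVec (coordScale r (pointExp z μ 0) y) =
      coordScale r (pointExp z (σ + μ) (σ + μ + (μ + δ)))
        (N.mulVec (coordScale r (pointExp z 0 δ) y)) := by
  ext i
  simp only [Matrix.mulVec, dotProduct, scaledMatrix, coordScale_apply, Finset.mul_sum]
  refine Finset.sum_congr rfl fun j _ => ?_
  unfold pointExp
  split_ifs <;> ring

theorem card_ker_pointExp (μ β : ℕ) :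
    Nat.card (coordScale r (pointExp z μ β)).ker =
      2 ^ ((Fintype.card ι - 1) * min r μ + min r β) := by
  rw [card_ker_coordScale, ← Finset.add_sum_erase _ _ (Finset.mem_univ z), add_comm]
  congr 2
  · rw [Finset.sum_congr rfl (g := fun _ => min r μ), Finset.sum_const,
      Finset.card_erase_of_mem (Finset.mem_univ z), Finset.card_univ, smul_eq_mul]
    intro i hi
    rw [pointExp, if_neg (Finset.ne_of_mem_erase hi)]
  · rw [pointExp, if_pos rfl]

/-- A vector that `N` (after scaling `z` by `2^δ`) sends into the kernel of the outer scaling yields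
an element of the kernel of the form. Confining the range of `N` to a subgroup `H` of index `2^ε`
gains the factor `2^ε`. -/
theorem le_card_ker_of_range_le (σ μ δ : ℕ) (hμ : σ + μ ≤ r)
    (H : AddSubgroup (ι → ZMod (2 ^ r))) (ε : ℕ)
    (hcard : 2 ^ ε * Nat.card H = Nat.card (ι → ZMod (2 ^ r)))
    (hker : (coordScale r (pointExp z (σ + μ) (σ + μ + (μ + δ)))).ker ≤ H)
    (hrange : ∀ y, N.mulVec (coordScale r (pointExp z 0 δ) y) ∈ H) :
    2 ^ ((Fintype.card ι - 1) * σ + min r (σ + μ + (μ + δ)) + ε) ≤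
      Nat.card (polarForm (scaledMatrix N z σ (μ + δ))).ker := by
  set D := coordScale r (pointExp z μ 0)
  set f : (ι → ZMod (2 ^ r)) →+ (ι → ZMod (2 ^ r)) :=
    N.mulVecLin.toAddMonoidHom.comp (coordScale r (pointExp z 0 δ))
  set S := (coordScale r (pointExp z (σ + μ) (σ + μ + (μ + δ)))).ker
  set T := (polarForm (scaledMatrix N z σ (μ + δ))).ker
  have h1 := AddSubgroup.card_mul_card_le_card_comap f hker
    (by rintro _ ⟨y, rfl⟩; exact hrange y)
  have h2 : S.comap f ≤ T.comap D := by
    intro y hy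
    rw [AddSubgroup.mem_comap, AddMonoidHom.mem_ker] at hy
    have hy' := (scaledMatrix_mulVec_coordScale N z σ μ δ y).trans hy
    exact AddSubgroup.mem_comap.2 (mem_ker_polarForm hy')
  have h3 := AddSubgroup.card_comap_le D T
  have h4 : Nat.card (S.comap f) ≤ Nat.card (T.comap D) :=
    Nat.card_le_card_of_injective _ (AddSubgroup.inclusion_injective h2)
  have hD : Nat.card D.ker = 2 ^ ((Fintype.card ι - 1) * μ) := by
    rw [card_ker_pointExp, min_eq_right (by omega : μ ≤ r)]; simp
  have hS : Nat.card S = 2 ^ ((Fintype.card ι - 1) * (σ + μ) + min r (σ + μ + (μ + δ))) := by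
    rw [card_ker_pointExp, min_eq_right hμ]
  have hH : 0 < Nat.card H := Nat.card_pos
  rw [← hcard, hS] at h1
  have h5 : 2 ^ ε * 2 ^ ((Fintype.card ι - 1) * (σ + μ) + min r (σ + μ + (μ + δ))) ≤
      Nat.card T * 2 ^ ((Fintype.card ι - 1) * μ) := by
    rw [← hD]
    refine le_trans (le_of_mul_le_mul_left ?_ hH) (h4.trans h3)
    calc _ = _ := by ring
      _ ≤ _ := h1
  refine Nat.le_of_mul_le_mul_right (c := 2 ^ ((Fintype.card ι - 1) * μ)) ?_ (by positivity)
  refine le_trans (le_of_eq ?_) h5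
  rw [← pow_add, ← pow_add]
  congr 1
  ring

theorem le_card_ker (σ μ δ : ℕ) (hμ : σ + μ ≤ r) :
    2 ^ ((Fintype.card ι - 1) * σ + min r (σ + μ + (μ + δ))) ≤
      Nat.card (polarForm (scaledMatrix N z σ (μ + δ))).ker :=
  le_card_ker_of_range_le N z σ μ δ hμ ⊤ 0 (by simp) le_top fun _ => AddSubgroup.mem_top _

/-- `u` is a relation modulo 2 among the rows of `N`, so the range lies in the index-two subgroup
cut out by `u`. Elements of the scaling kernel lie there too, as their coordinates are even wherever
`u` is nonzero. Column `z` needs no relation when `δ > 0`, since it then carries an even factor. -/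
theorem le_card_ker_of_annihilator (hr : 1 ≤ r) (μ δ : ℕ) (hμ : μ < r)
    (u : ι → ZMod 2) (hu : u ≠ 0) (hz : u z = 0 ∨ μ + (μ + δ) < r)
    (hN : ∀ j, (j = z → δ = 0) →
      ∑ i, u i * ZMod.castHom (dvd_pow_self 2 (by omega)) (ZMod 2) (N i j) = 0) :
    2 ^ (min r (μ + (μ + δ)) + 1) ≤
      Nat.card (polarForm (scaledMatrix N z 0 (μ + δ))).ker := by
  obtain ⟨H, hH, hmem⟩ := exists_index_two hr u hu
  have := le_card_ker_of_range_le N z 0 μ δ (by omega) H 1 (by rw [pow_one, hH]) ?_ ?_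
  · simpa using this
  · intro y hy
    rw [hmem]
    refine Finset.sum_eq_zero fun i _ => ?_
    have hy1 := congrFun (AddMonoidHom.mem_ker.1 hy) i
    have key : ∀ c < r, 2 ^ c * y i = 0 →
        ZMod.castHom (dvd_pow_self 2 (show r ≠ 0 by omega)) (ZMod 2) (y i) = 0 := by
      intro c hc hcy
      obtain ⟨m, hm⟩ := ZMod.natCast_zmod_surjective (y i)
      rw [← hm] at hcy ⊢
      rw [map_natCast, ZMod.natCast_eq_zero_iff]
      have h1 : ((2 ^ c * m : ℕ) : ZMod (2 ^ r)) = 0 := by push_cast; exact hcy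
      rw [ZMod.natCast_eq_zero_iff] at h1
      have h2 : 2 ^ c * 2 ∣ 2 ^ c * m := by
        rw [← pow_succ]; exact (pow_dvd_pow 2 hc).trans h1
      exact Nat.dvd_of_mul_dvd_mul_left (by positivity) h2
    rw [coordScale_apply, pointExp, Pi.zero_apply] at hy1
    split_ifs at hy1 with hi
    · rcases hz with hz | hz
      · rw [hi, hz, zero_mul]
      · rw [key _ (by omega) hy1, mul_zero]
    · rw [key _ (by omega) hy1, mul_zero]
  · intro y
    rw [hmem]
    simp only [Matrix.mulVec, dotProduct, map_sum, map_mul, Finset.mul_sum, coordScale_apply]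
    rw [Finset.sum_comm]
    refine Finset.sum_eq_zero fun j _ => ?_
    by_cases hj : j = z → δ = 0
    · simp only [← mul_assoc]
      rw [← Finset.sum_mul, ← Finset.sum_mul, hN j hj, zero_mul, zero_mul]
    · push Not at hj
      refine Finset.sum_eq_zero fun i _ => ?_
      have h2 : (2 : ZMod 2) = 0 := rfl
      rw [pointExp, if_pos hj.1, map_pow, map_ofNat, h2, zero_pow hj.2]
      ring

/-- Modulo 2 the matrix is alternating, so its principal submatrix on `p` is singular; a null vector
of it is extended by zero. -/
theorem exists_annihilator (hr : 1 ≤ r) (hN : N.transpose = N)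
    (hd : ∀ i, (2 : ZMod (2 ^ r)) ∣ N i i) (p : ι → Prop) [DecidablePred p]
    (hp : Odd (Fintype.card {i // p i})) :
    ∃ u : ι → ZMod 2, u ≠ 0 ∧ (∀ i, ¬ p i → u i = 0) ∧ ∀ j, p j →
      ∑ i, u i * ZMod.castHom (dvd_pow_self 2 (by omega)) (ZMod 2) (N i j) = 0 := by
  set φ := ZMod.castHom (dvd_pow_self 2 (show r ≠ 0 by omega)) (ZMod 2)
  let A : Matrix {i // p i} {i // p i} (ZMod 2) := Matrix.of fun i j => φ (N i j)
  have hA : A.det = 0 := by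
    refine Matrix.det_eq_zero_of_odd_card hp A ?_ ?_
    · ext i j
      exact congrArg φ (congrFun (congrFun hN i.1) j.1)
    · intro i
      obtain ⟨c, hc⟩ := hd i
      have h2 : (2 : ZMod 2) = 0 := rfl
      simp only [A, Matrix.of_apply]
      rw [hc, map_mul, map_ofNat, h2, zero_mul]
  obtain ⟨v, hv, hvA⟩ := Matrix.exists_vecMul_eq_zero_iff.2 hA
  refine ⟨fun i => if h : p i then v ⟨i, h⟩ else 0, ?_, ?_, ?_⟩
  · obtain ⟨i, hi⟩ := Function.ne_iff.1 hv
    refine Function.ne_iff.2 ⟨i.1, ?_⟩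
    simpa [i.2] using hi
  · intro i hi
    simp [hi]
  · intro j hj
    have h := congrFun hvA ⟨j, hj⟩
    rw [Matrix.vecMul, dotProduct, Pi.zero_apply] at h
    refine (Fintype.sum_subtype_add_sum_subtype p _).symm.trans ?_
    rw [Finset.sum_eq_zero (s := (Finset.univ : Finset {i // ¬ p i})), add_zero]
    · refine Eq.trans (Finset.sum_congr rfl fun i _ => ?_) h
      simp only [dif_pos i.2]
      rfl
    · intro i _
      simp only [dif_neg i.2, zero_mul]

theorem lt_card_ker_of_odd (hr : 1 ≤ r) (hN : N.transpose = N)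
    (hd : ∀ i, (2 : ZMod (2 ^ r)) ∣ N i i) (hι : Odd (Fintype.card ι)) (β : ℕ) (hβ : 2 * β < r) :
    2 ^ (2 * β + 1) ≤ Nat.card (polarForm (scaledMatrix N z 0 β)).ker := by
  obtain ⟨u, hu, -, hN⟩ := exists_annihilator N hr hN hd (fun _ => True)
    (by rwa [Fintype.card_subtype_true])
  have := le_card_ker_of_annihilator N z hr β 0 (by omega) u hu (Or.inr (by omega))
    fun j _ => hN j trivial
  rwa [min_eq_right (by omega), add_zero, ← two_mul] at this

theorem lt_card_ker_of_even (hr : 1 ≤ r) (hN : N.transpose = N)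
    (hd : ∀ i, (2 : ZMod (2 ^ r)) ∣ N i i) (hι : Even (Fintype.card ι)) (β : ℕ) (hβr : β ≤ r)
    (hβ : r < 2 * β) :
    2 ^ (r + 1) ≤ Nat.card (polarForm (scaledMatrix N z 0 β)).ker := by
  have hpos : 0 < Fintype.card ι := Fintype.card_pos_iff.2 ⟨z⟩
  obtain ⟨u, hu, hz, hN⟩ := exists_annihilator N hr hN hd (fun i => i ≠ z) (by
    rw [Fintype.card_subtype_compl, Fintype.card_subtype_eq]
    exact Nat.Even.sub_odd hpos hι odd_one)
  -- With `z` removed an odd number of indices remains. Here `μ + δ = β` and `2μ + δ = r`, and `δ >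
  -- 0` takes care of column `z`.
  have := le_card_ker_of_annihilator N z hr (r - β) (2 * β - r) (by omega) u hu
    (Or.inl (hz z (by simp))) fun j hj => hN j fun h => by have := hj h; omega
  rwa [show r - β + (2 * β - r) = β by omega, show r - β + β = r by omega, min_self] at this

end PolarForm

theorem divExp_eq (r n v : ℕ) (hn : 1 ≤ n) :
    divExp r n v = (r * (n - 1) + min (2 * v) r + 1) / 2 := by
  obtain ⟨m, rfl⟩ : ∃ m, n = m + 1 := ⟨n - 1, by omega⟩
  rw [divExp]
  have h : ((r * (((m + 1 : ℕ) : ℚ) - 1) + min (2 * v) r : ℚ) / 2) =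
      ((r * m + min (2 * v) r : ℕ) : ℚ) / 2 := by push_cast; ring
  rw [h, Nat.add_sub_cancel]
  set E := r * m + min (2 * v) r
  apply le_antisymm
  · rw [Nat.ceil_le]
    have : E ≤ 2 * ((E + 1) / 2) := by omega
    have h2 : (E : ℚ) ≤ 2 * ((E + 1) / 2 : ℕ) := by exact_mod_cast this
    linarith
  · have h1 := Nat.le_ceil ((E : ℚ) / 2)
    have h2 : (E : ℚ) ≤ (2 * ⌈(E : ℚ) / 2⌉₊ : ℕ) := by push_cast; linarith
    have h3 : E ≤ 2 * ⌈(E : ℚ) / 2⌉₊ := by exact_mod_cast h2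
    omega

/-! ### The bound for the kernel against the required exponent. -/

section KernelBound

variable {r : ℕ} {ι : Type*} [Fintype ι]

theorem exists_card_eq_two_pow (S : AddSubgroup (ι → ZMod (2 ^ r))) :
    ∃ m, Nat.card S = 2 ^ m := by
  have h := AddSubgroup.card_addSubgroup_dvd_card S
  rw [Nat.card_fun, Nat.card_zmod, ← pow_mul] at h
  obtain ⟨m, -, hm⟩ := (Nat.dvd_prime_pow Nat.prime_two).1 h
  exact ⟨m, hm⟩

/-- With `β = r - v` the kernel must have order at least `2^(min(r, 2β) + 2σ)`, and twice that if
the ceiling rounds up. All orders are powers of 2, so inequalities suffice. -/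
theorem two_pow_dvd_card_mul_card_ker [DecidableEq ι] (N : Matrix ι ι (ZMod (2 ^ r))) (z : ι) (hr : 1 ≤ r)
    (hN : N.transpose = N) (hd : ∀ i, (2 : ZMod (2 ^ r)) ∣ N i i) (hι : 3 ≤ Fintype.card ι)
    (v σ : ℕ) (hv : v ≤ r) (hσ : σ < r) :
    2 ^ (2 * (divExp r (Fintype.card ι) v + (r - v) + σ)) ∣
      Nat.card (ι → ZMod (2 ^ r)) *
        Nat.card (polarForm (scaledMatrix N z σ (r - v))).ker := by
  obtain ⟨m, hm⟩ := exists_card_eq_two_pow (polarForm (scaledMatrix N z σ (r - v))).ker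
  rw [divExp_eq _ _ _ (by omega)]
  obtain ⟨β, hβ⟩ : ∃ β, β = r - v := ⟨_, rfl⟩
  rw [← hβ] at hm ⊢
  -- This choice of `μ` makes the last exponent `min(r, σ + 2β)`, whether or not `σ + 2β` exceeds
  -- `r`.
  have hgen := le_card_ker N z σ (min β (r - σ - β)) (β - min β (r - σ - β)) (by omega)
  rw [show min β (r - σ - β) + (β - min β (r - σ - β)) = β by omega, hm,
    Nat.pow_le_pow_iff_right (by norm_num)] at hgen
  have hodd := fun hι h2 => lt_card_ker_of_odd N z hr hN hd hι β h2
  have heven := fun hι h2 => lt_card_ker_of_even N z hr hN hd hι β (by omega) h2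
  rw [hm, Nat.card_fun, Nat.card_zmod, ← pow_mul, ← pow_add]
  apply pow_dvd_pow
  have hcard : Nat.card ι = Fintype.card ι := Nat.card_eq_fintype_card
  rw [hcard]
  obtain ⟨n, hn⟩ : ∃ n, Fintype.card ι = n + 1 := ⟨Fintype.card ι - 1, by omega⟩
  rw [hn, Nat.add_sub_cancel] at hgen ⊢
  rw [hn] at hodd heven
  have hA : r * (n + 1) = r * n + r := by ring
  have h2 : 2 * σ ≤ n * σ := Nat.mul_le_mul_right σ (by omega)
  rw [hA]
  rcases Nat.even_or_odd (r * n + min (2 * v) r) with hE | hE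
  -- From here `n` is one less than the number of variables. No rounding: `nσ ≥ 2σ` is enough.
  · rw [Nat.even_iff] at hE
    omega
  · have hpar : Even n ∨ 3 * σ ≤ n * σ := by
      rcases Nat.even_or_odd n with h | h
      · exact Or.inl h
      · right
        rw [Nat.odd_iff] at h
        exact Nat.mul_le_mul_right σ (by omega)
    have hrn : (Even n ∧ (r * n) % 2 = 0) ∨ (Odd n ∧ (r * n) % 2 = r % 2) := by
      rcases Nat.even_or_odd n with h | h
      · exact Or.inl ⟨h, Nat.even_iff.1 (h.mul_left r)⟩
      · refine Or.inr ⟨h, ?_⟩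
        rw [Nat.mul_mod, Nat.odd_iff.1 h]
        omega
    rw [Nat.odd_iff] at hE
    -- Rounding up forces `r` odd, with `2β < r` if `n` is even and `2β > r` if `n` is odd. For `σ =
    -- 0` these are the two degenerate alternating cases. For `σ > 0` the extra factor comes from
    -- `min(r, σ + 2β) > 2β` or from `nσ ≥ 3σ`.
    rcases Nat.eq_zero_or_pos σ with rfl | hσ0
    · rw [hm] at hodd heven
      simp only [Nat.pow_le_pow_iff_right (show 1 < 2 by norm_num)] at hodd heven
      rcases hrn with ⟨h, hmod⟩ | ⟨h, hmod⟩
      · have := hodd h.add_one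
        omega
      · have := heven h.add_one
        omega
    · rcases hpar with h | h
      · rcases hrn with ⟨_, hmod⟩ | ⟨h', _⟩
        · omega
        · exact absurd h (Nat.not_even_iff_odd.2 h')
      · omega

end KernelBound

/-! ### Solution counts modulo smaller powers of 2. -/

section Levels

variable {a : ℕ} {V : Type*} [Fintype V]

theorem two_mul_eq_zero_iff (t : ZMod (2 ^ (a + 1))) : 2 * t = 0 ↔ t = 0 ∨ t = 2 ^ a := by
  constructor
  · intro h
    obtain ⟨m, rfl⟩ := ZMod.natCast_zmod_surjective t
    have h1 : ((2 * m : ℕ) : ZMod (2 ^ (a + 1))) = 0 := by push_cast; exact h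
    rw [ZMod.natCast_eq_zero_iff, pow_succ'] at h1
    obtain ⟨c, rfl⟩ := Nat.dvd_of_mul_dvd_mul_left (by norm_num) h1
    rcases Nat.even_or_odd' c with ⟨d, rfl | rfl⟩
    · left
      push_cast
      linear_combination (d : ZMod (2 ^ (a + 1))) * TwoPowCyclotomic.half_add_half a
    · right
      push_cast
      linear_combination (d : ZMod (2 ^ (a + 1))) * TwoPowCyclotomic.half_add_half a
  · rintro (rfl | rfl)
    · ring
    · rw [two_mul, TwoPowCyclotomic.half_add_half]

/-- The number of points at which `P` is congruent to `k` modulo `2 ^ (a + 1 - σ)`. -/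
def levelCount (P : V → ZMod (2 ^ (a + 1))) (σ : ℕ) (k : ZMod (2 ^ (a + 1))) : ℕ :=
  (Finset.univ.filter fun x => 2 ^ σ * P x = 2 ^ σ * k).card

theorem levelCount_half (P : V → ZMod (2 ^ (a + 1))) {σ : ℕ}
    (k k' : ZMod (2 ^ (a + 1))) (hk : 2 ^ σ * k' = 2 ^ σ * k + 2 ^ a) :
    levelCount P (σ + 1) k = levelCount P σ k + levelCount P σ k' := by
  classical
  rw [levelCount, levelCount, levelCount, ← Finset.card_union_of_disjoint]
  · congr 1
    ext x
    simp only [Finset.mem_filter, Finset.mem_univ, true_and, Finset.mem_union, hk]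
    have h := two_mul_eq_zero_iff (2 ^ σ * P x - 2 ^ σ * k)
    rw [sub_eq_zero, sub_eq_iff_eq_add, add_comm (2 ^ a)] at h
    have hp : (2 : ZMod (2 ^ (a + 1))) ^ (σ + 1) = 2 * 2 ^ σ := pow_succ' _ _
    rw [← h, ← sub_eq_zero, hp]
    constructor <;> intro h' <;> linear_combination h'
  · rw [Finset.disjoint_filter]
    intro x _ h1 h2
    rw [hk, h1, left_eq_add] at h2
    have h3 : ((2 ^ a : ℕ) : ZMod (2 ^ (a + 1))) = 0 := by push_cast; exact h2
    rw [ZMod.natCast_eq_zero_iff, Nat.pow_dvd_pow_iff_le_right (by norm_num)] at h3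
    omega

theorem levelCount_shift {σ : ℕ} (hσ : σ ≤ a) (k : ZMod (2 ^ (a + 1))) :
    2 ^ σ * (k + 2 ^ (a - σ)) = 2 ^ σ * k + 2 ^ a := by
  rw [mul_add, ← pow_add, Nat.add_sub_cancel' hσ]

theorem two_pow_dvd_levelCount (P : V → ZMod (2 ^ (a + 1))) (F : ℕ)
    (h : ∀ σ ≤ a, ∀ k k', 2 ^ σ * k' = 2 ^ σ * k + 2 ^ a →
      (2 : ℤ) ^ (F + σ + 1) ∣ (levelCount P σ k : ℤ) - levelCount P σ k')
    (htop : 2 ^ (F + (a + 1)) ∣ Fintype.card V) {σ : ℕ} (hσ : σ ≤ a + 1) :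
    ∀ k, 2 ^ (F + σ) ∣ levelCount P σ k := by
  induction hσ using Nat.decreasingInduction with
  | self =>
    intro k
    -- At the coarsest level the congruence is empty and every point counts.
    have h0 : (2 ^ (a + 1) : ZMod (2 ^ (a + 1))) = 0 := by
      linear_combination TwoPowCyclotomic.half_add_half a
    simpa only [levelCount, h0, zero_mul, Finset.filter_true, Finset.card_univ] using htop
  | of_succ σ hσ ih =>
    intro k
    have hσ' : σ ≤ a := by omega
    have h1 := h σ hσ' k _ (levelCount_shift hσ' k)
    have h2 := ih k
    rw [levelCount_half P k _ (levelCount_shift hσ' k)] at h2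
    have h3 := Int.natCast_dvd_natCast.2 h2
    push_cast at h3
    have h4 := dvd_add h1 h3
    have h5 : ((levelCount P σ k : ℤ) - levelCount P σ (k + 2 ^ (a - σ))) +
        (levelCount P σ k + levelCount P σ (k + 2 ^ (a - σ))) = 2 * levelCount P σ k := by ring
    rw [h5, pow_succ'] at h4
    have h6 := Int.dvd_of_mul_dvd_mul_left (by norm_num) h4
    exact_mod_cast h6

theorem Finset.sum_range_two_mul {M : Type*} [AddCommMonoid M] (f : ℕ → M) (m : ℕ) :
    ∑ i ∈ Finset.range (2 * m), f i = ∑ i ∈ Finset.range m, (f (2 * i) + f (2 * i + 1)) := by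
  induction m with
  | zero => simp
  | succ m ih =>
    rw [Finset.sum_range_succ, ← ih, mul_add, mul_one, Finset.sum_range_succ,
      Finset.sum_range_succ, add_assoc]

/-- For odd `w` the progression meets each residue in the class of `k` modulo `2^(a+1-q)` once. In
the induction even and odd `i` give the two halves of that class. -/
theorem sum_levelCount_of_odd (P : V → ZMod (2 ^ (a + 1))) {w : ℤ} (hw : Odd w) {q : ℕ}
    (hq : q ≤ a + 1) : ∀ k, ∑ i ∈ Finset.range (2 ^ q),
      levelCount P 0 (k + w * 2 ^ (a + 1 - q) * i) = levelCount P q k := by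
  induction q with
  | zero => simp
  | succ q ih =>
    intro k
    have hk : (2 : ZMod (2 ^ (a + 1))) ^ q * (k + w * 2 ^ (a - q)) = 2 ^ q * k + 2 ^ a := by
      obtain ⟨d, rfl⟩ := hw
      have h := levelCount_shift (show q ≤ a by omega) k
      have h1 : (2 : ZMod (2 ^ (a + 1))) ^ q * 2 ^ (a - q) = 2 ^ a := by
        rw [← pow_add, Nat.add_sub_cancel' (by omega)]
      push_cast
      linear_combination (2 * d + 1 : ZMod (2 ^ (a + 1))) * h1 +
        (d : ZMod (2 ^ (a + 1))) * TwoPowCyclotomic.half_add_half a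
    rw [pow_succ', Finset.sum_range_two_mul, Finset.sum_add_distrib,
      levelCount_half P k _ hk, ← ih (by omega), ← ih (by omega)]
    have h2 : (2 : ZMod (2 ^ (a + 1))) ^ (a + 1 - q) = 2 * 2 ^ (a - q) := by
      rw [← pow_succ', show a + 1 - q = a - q + 1 by omega]
    congr 1 <;> refine Finset.sum_congr rfl fun i _ => congrArg _ ?_ <;>
      rw [h2, show a + 1 - (q + 1) = a - q by omega] <;> push_cast <;> ring

theorem two_pow_dvd_sum_levelCount (P : V → ZMod (2 ^ (a + 1))) (F : ℕ)
    (h : ∀ σ ≤ a + 1, ∀ k, 2 ^ (F + σ) ∣ levelCount P σ k) {q : ℕ} (hq : q ≤ a + 1) :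
    ∀ (w : ℤ) (k : ZMod (2 ^ (a + 1))), 2 ^ (F + q) ∣ ∑ i ∈ Finset.range (2 ^ q),
      levelCount P 0 (k + w * 2 ^ (a + 1 - q) * i) := by
  induction q with
  | zero => intro w k; simpa using h 0 (by omega) k
  | succ q ih =>
    intro w k
    rcases Int.even_or_odd' w with ⟨d, hw | hw⟩
    · have h2 : (2 : ZMod (2 ^ (a + 1))) ^ (a + 1 - q) = 2 * 2 ^ (a - q) := by
        rw [← pow_succ', show a + 1 - q = a - q + 1 by omega]
      have h1 : (2 : ZMod (2 ^ (a + 1))) ^ (a - q) * 2 ^ q = 2 ^ a := by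
        rw [← pow_add, Nat.sub_add_cancel (by omega)]
      have h3 := ih (by omega) d k
      -- For `w = 2d` the progression repeats after `2^q` terms, so the sum is twice the one for
      -- `d`.
      rw [show F + (q + 1) = F + q + 1 by ring, pow_succ, pow_succ, mul_two (2 ^ q),
        Finset.sum_range_add, mul_two, ← two_mul]
      have h4 : ∀ i : ℕ, k + w * 2 ^ (a + 1 - (q + 1)) * ((2 ^ q + i : ℕ) : ZMod (2 ^ (a + 1))) =
          k + d * 2 ^ (a + 1 - q) * i := by
        intro i
        rw [h2, hw, show a + 1 - (q + 1) = a - q by omega]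
        push_cast
        linear_combination 2 * (d : ZMod (2 ^ (a + 1))) * h1 +
          (d : ZMod (2 ^ (a + 1))) * TwoPowCyclotomic.half_add_half a
      have h5 : ∀ i : ℕ, k + w * 2 ^ (a + 1 - (q + 1)) * (i : ZMod (2 ^ (a + 1))) =
          k + d * 2 ^ (a + 1 - q) * i := by
        intro i
        rw [h2, hw, show a + 1 - (q + 1) = a - q by omega]
        push_cast
        ring
      simp only [h4, h5]
      rw [← two_mul]
      exact mul_dvd_mul_left 2 h3
    · rw [sum_levelCount_of_odd P ⟨d, hw⟩ hq]
      exact h _ hq k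

end Levels

/-! ### Quadratic polynomials and their restriction along `z`. -/

theorem MvPolynomial.exists_eval_eq_of_totalDegree_le_two {R ι : Type*} [CommRing R] [Fintype ι]
    (Q : MvPolynomial ι R) (hQ : Q.totalDegree ≤ 2) :
    ∃ (c : R) (ℓ : ι → R) (A : Matrix ι ι R), ∀ p : ι → R, MvPolynomial.eval p Q =
      c + ∑ i, ℓ i * p i + ∑ i, ∑ j, p i * A i j * p j := by
  classical
  have key : ∀ (s : Finset (ι →₀ ℕ)) (f : (ι →₀ ℕ) → R), (∀ d ∈ s, d.degree ≤ 2) →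
      ∃ (c : R) (ℓ : ι → R) (A : Matrix ι ι R), ∀ p : ι → R,
        ∑ d ∈ s, f d * ∏ i, p i ^ d i = c + ∑ i, ℓ i * p i + ∑ i, ∑ j, p i * A i j * p j := by
    intro s f
    induction s using Finset.induction_on with
    | empty => intro _; exact ⟨0, 0, 0, by simp⟩
    | insert d s hd ih =>
      intro hs
      obtain ⟨c, ℓ, A, h⟩ := ih fun e he => hs e (Finset.mem_insert_of_mem he)
      have hd2 := hs d (Finset.mem_insert_self d s)
      have hmono : ∃ (c : R) (ℓ : ι → R) (A : Matrix ι ι R), ∀ p : ι → R,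
          ∏ i, p i ^ d i = c + ∑ i, ℓ i * p i + ∑ i, ∑ j, p i * A i j * p j := by
        have hsplit : ∀ e : ι →₀ ℕ, e ≠ 0 → ∃ i e', e = Finsupp.single i 1 + e' := by
          intro e he
          obtain ⟨i, hi⟩ := Finsupp.ne_iff.1 he
          refine ⟨i, e - Finsupp.single i 1, (add_tsub_cancel_of_le ?_).symm⟩
          rw [Finsupp.single_le_iff]
          exact Nat.one_le_iff_ne_zero.2 hi
        have hprod : ∀ (p : ι → R) (i : ι) (e : ι →₀ ℕ),
            ∏ j, p j ^ ((Finsupp.single i 1 + e : ι →₀ ℕ) j) = p i * ∏ j, p j ^ e j := by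
          intro p i e
          simp only [Finsupp.add_apply, pow_add, Finset.prod_mul_distrib]
          congr 1
          rw [Finset.prod_eq_single i] <;> simp +contextual [eq_comm]
        by_cases h0 : d = 0
        · exact ⟨1, 0, 0, by simp [h0]⟩
        obtain ⟨i, e, rfl⟩ := hsplit d h0
        by_cases h1 : e = 0
        · refine ⟨0, Pi.single i 1, 0, fun p => ?_⟩
          rw [hprod, h1]
          simp [Pi.single_apply]
        obtain ⟨j, e', rfl⟩ := hsplit e h1
        have he' : e' = 0 := by
          rw [map_add, map_add, Finsupp.degree_single, Finsupp.degree_single] at hd2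
          exact (Finsupp.degree_eq_zero_iff _).1 (by omega)
        refine ⟨0, 0, Matrix.single i j 1, fun p => ?_⟩
        rw [hprod, hprod, he']
        simp [Matrix.single_apply, ite_and]
      obtain ⟨c', ℓ', A', h'⟩ := hmono
      refine ⟨f d * c' + c, fun i => f d * ℓ' i + ℓ i,
        fun i j => f d * A' i j + A i j, fun p => ?_⟩
      rw [Finset.sum_insert hd, h, h']
      simp only [add_mul, mul_add, Finset.sum_add_distrib, Finset.mul_sum]
      have h1 : ∀ i j, p i * (f d * A' i j) * p j = f d * (p i * A' i j * p j) :=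
        fun i j => by ring
      simp only [h1, mul_assoc]
      ring
  obtain ⟨c, ℓ, A, h⟩ := key Q.support (fun d => Q.coeff d) fun d hd => by
    refine le_trans ?_ hQ
    rw [Finsupp.degree_eq_sum]
    refine le_trans (le_of_eq ?_) (MvPolynomial.le_totalDegree hd)
    rw [Finsupp.sum_fintype _ _ (by simp)]
  exact ⟨c, ℓ, A, fun p => by rw [MvPolynomial.eval_eq', h]⟩

section Restriction

variable {r n : ℕ}

/-- The polynomial `Q` after the substitution `z ↦ l + g 2 ^ β z`, minus `w z`. -/
noncomputable def restricted (Q : MvPolynomial (Fin n) (ZMod (2 ^ r))) (z : Fin n) (β : ℕ)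
    (l g w : ZMod (2 ^ r)) (p : Fin n → ZMod (2 ^ r)) : ZMod (2 ^ r) :=
  MvPolynomial.eval (Function.update p z (l + g * 2 ^ β * p z)) Q - w * p z

theorem exists_polarForm (Q : MvPolynomial (Fin n) (ZMod (2 ^ r))) (hQ : Q.totalDegree ≤ 2)
    (z : Fin n) (β : ℕ) (l g w : ZMod (2 ^ r)) :
    ∃ N : Matrix (Fin n) (Fin n) (ZMod (2 ^ r)), N.transpose = N ∧
      (∀ i, (2 : ZMod (2 ^ r)) ∣ N i i) ∧ ∀ x h, restricted Q z β l g w (x + h) +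
        restricted Q z β l g w 0 = restricted Q z β l g w x + restricted Q z β l g w h +
          polarForm (scaledMatrix N z 0 β) h x := by
  obtain ⟨c, ℓ, A, hA⟩ := MvPolynomial.exists_eval_eq_of_totalDegree_le_two Q hQ
  let γ : Fin n → ZMod (2 ^ r) := fun i => if i = z then g else 1
  let o : Fin n → ZMod (2 ^ r) := fun i => if i = z then l else 0
  let d : Fin n → ZMod (2 ^ r) := fun i => γ i * 2 ^ pointExp z 0 β i
  have hupd : ∀ p : Fin n → ZMod (2 ^ r),
      Function.update p z (l + g * 2 ^ β * p z) = fun i => o i + d i * p i := by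
    intro p
    ext i
    by_cases hi : i = z
    · subst hi
      simp [o, d, γ, pointExp]
    · simp [o, d, γ, pointExp, hi]
  have hrest : ∀ p, restricted Q z β l g w p = c + ∑ i, ℓ i * (o i + d i * p i) +
      ∑ i, ∑ j, (o i + d i * p i) * A i j * (o j + d j * p j) - w * p z := by
    intro p
    rw [restricted, hupd, hA]
  -- The polar form uses `A` plus its transpose, hence the even diagonal; the factor `g` is absorbed
  -- into `N`, leaving a pure power of 2 at `z`.
  refine ⟨Matrix.of fun i j => γ i * (A i j + A j i) * γ j, ?_, ?_, ?_⟩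
  · ext i j
    simp only [Matrix.transpose_apply, Matrix.of_apply]
    ring
  · intro i
    exact ⟨γ i * A i i * γ i, by simp only [Matrix.of_apply]; ring⟩
  · intro x h
    have hB : polarForm (scaledMatrix (Matrix.of fun i j => γ i * (A i j + A j i) * γ j) z 0 β) h x
        = ∑ i, ∑ j, (d i * x i * A i j * (d j * h j)) +
          ∑ i, ∑ j, (d i * h i * A i j * (d j * x j)) := by
      rw [Finset.sum_comm (f := fun i j => d i * h i * A i j * (d j * x j)),
        ← Finset.sum_add_distrib, polarForm_apply]
      simp only [dotProduct, Matrix.mulVec, Finset.mul_sum, ← Finset.sum_add_distrib]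
      refine Finset.sum_congr rfl fun i _ => Finset.sum_congr rfl fun j _ => ?_
      simp only [scaledMatrix, Matrix.of_apply, d]
      ring
    have hq : ∀ i j, (o i + d i * (x i + h i)) * A i j * (o j + d j * (x j + h j)) =
        (o i + d i * x i) * A i j * (o j + d j * x j) +
        (o i + d i * h i) * A i j * (o j + d j * h j) - (o i + d i * 0) * A i j * (o j + d j * 0) +
        (d i * x i * A i j * (d j * h j) + d i * h i * A i j * (d j * x j)) := by
      intro i j; ring
    have hl : ∀ i, ℓ i * (o i + d i * (x i + h i)) = ℓ i * (o i + d i * x i) +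
        ℓ i * (o i + d i * h i) - ℓ i * (o i + d i * 0) := by
      intro i; ring
    simp only [hrest, hB, Pi.add_apply, Pi.zero_apply, hq, hl,
      Finset.sum_add_distrib, Finset.sum_sub_distrib]
    ring

theorem polarForm_scaledMatrix_level (N : Matrix (Fin n) (Fin n) (ZMod (2 ^ r))) (z : Fin n)
    (σ β : ℕ) (h x : Fin n → ZMod (2 ^ r)) :
    polarForm (scaledMatrix N z σ β) h x = 2 ^ σ * polarForm (scaledMatrix N z 0 β) h x := by
  simp only [polarForm_apply, dotProduct, Matrix.mulVec, Finset.mul_sum, scaledMatrix]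
  refine Finset.sum_congr rfl fun i _ => Finset.sum_congr rfl fun j _ => ?_
  ring

theorem divExp_pos (hr : 1 ≤ r) (hn : 3 ≤ n) (v : ℕ) : 1 ≤ divExp r n v := by
  rw [divExp_eq _ _ _ (by omega)]
  have : 1 * 2 ≤ r * (n - 1) := Nat.mul_le_mul hr (by omega)
  omega

theorem divExp_add_le (hr : 1 ≤ r) (hn : 3 ≤ n) {v : ℕ} (hv : v ≤ r) :
    divExp r n v - 1 + (r - v) + r ≤ r * n := by
  rw [divExp_eq _ _ _ (by omega)]
  obtain ⟨m, rfl⟩ : ∃ m, n = m + 3 := ⟨n - 3, by omega⟩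
  rw [show m + 3 - 1 = m + 2 by omega, show r * (m + 2) = r * m + 2 * r by ring,
    show r * (m + 3) = r * m + 3 * r by ring]
  omega

/-- Fixing `p z = t` gives the `t`-th summand. The hypothesis `hw` makes the summands periodic in
`t` modulo `2^v`, so the `2^r` values of `t` run through the sum `2^(r-v)` times. -/
theorem card_restricted_eq (Q : MvPolynomial (Fin n) (ZMod (2 ^ r))) (z : Fin n) (v : ℕ)
    (hv : v ≤ r) (l g k w : ℤ) (hw : (2 ^ r : ℤ) ∣ w * 2 ^ v) :
    (Finset.univ.filter fun p => restricted Q z (r - v) l g w p = k).card =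
      2 ^ (r - v) * ∑ j ∈ Finset.range (2 ^ v),
        solCount Q (k + w * j) z (l + g * 2 ^ (r - v) * j) := by
  classical
  have hcong : ∀ k k' c c' : ℤ, (k : ZMod (2 ^ r)) = k' → (c : ZMod (2 ^ r)) = c' →
      solCount Q k z c = solCount Q k' z c' := by
    intro k k' c c' h1 h2
    rw [solCount, solCount, h1, h2]
  set s : ℕ → ℕ := fun j => solCount Q (k + w * j) z (l + g * 2 ^ (r - v) * j) with hs
  have hr0 : (2 : ZMod (2 ^ r)) ^ r = 0 := by
    have := ZMod.natCast_self (2 ^ r)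
    push_cast at this
    exact this
  have hper : ∀ m j, s (2 ^ v * m + j) = s j := by
    intro m j
    refine hcong _ _ _ _ ?_ ?_
    · obtain ⟨c, hc⟩ := hw
      have hc' := congrArg (Int.cast : ℤ → ZMod (2 ^ r)) hc
      push_cast at hc' ⊢
      linear_combination (m : ZMod (2 ^ r)) * hc' + (m * c : ZMod (2 ^ r)) * hr0
    · have h1 : (2 : ZMod (2 ^ r)) ^ (r - v) * 2 ^ v = 0 := by
        rw [← pow_add, Nat.sub_add_cancel hv, hr0]
      push_cast
      linear_combination (g * m : ZMod (2 ^ r)) * h1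
  have hblocks : ∀ m, ∑ j ∈ Finset.range (2 ^ v * m), s j =
      m * ∑ j ∈ Finset.range (2 ^ v), s j := by
    intro m
    induction m with
    | zero => simp
    | succ m ih =>
      rw [mul_add, mul_one, Finset.sum_range_add, ih]
      simp only [hper]
      ring
  have hfiber : ∀ t : ZMod (2 ^ r), ((Finset.univ.filter fun p =>
      restricted Q z (r - v) l g w p = k).filter fun p => p z = t).card = s t.val := by
    intro t
    rw [hs]
    simp only [solCount]
    rw [Set.ncard_eq_toFinset_card', Finset.filter_filter]
    refine Finset.card_nbij' (fun p => Function.update p z (l + g * 2 ^ (r - v) * t))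
      (fun p => Function.update p z t) ?_ ?_ ?_ ?_
    · intro p hp
      simp only [Finset.coe_filter, Finset.mem_univ, true_and, Set.mem_ofPred_eq] at hp
      obtain ⟨h1, rfl⟩ := hp
      rw [restricted, sub_eq_iff_eq_add] at h1
      simp [h1]
    · intro p hp
      simp only [Set.coe_toFinset, Set.mem_ofPred_eq] at hp
      obtain ⟨h1, h2⟩ := hp
      push_cast at h1 h2
      rw [ZMod.natCast_zmod_val] at h1 h2
      simp only [Finset.coe_filter, Finset.mem_univ, true_and, Set.mem_ofPred_eq]
      refine ⟨?_, Function.update_self _ _ _⟩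
      rw [restricted, Function.update_self, Function.update_idem, ← h2, Function.update_eq_self, h1]
      ring
    · intro p hp
      simp only [Finset.coe_filter, Finset.mem_univ, true_and, Set.mem_ofPred_eq] at hp
      simp [← hp.2]
    · intro p hp
      simp only [Set.coe_toFinset, Set.mem_ofPred_eq] at hp
      obtain ⟨h1, h2⟩ := hp
      push_cast at h2
      rw [ZMod.natCast_zmod_val] at h2
      simp [← h2]
  rw [Finset.card_eq_sum_card_fiberwise (f := fun p => p z) (t := Finset.univ) (by simp)]
  rw [Finset.sum_congr rfl fun t _ => hfiber t]
  rw [← hblocks, ← pow_add, Nat.add_sub_cancel' hv]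
  refine Finset.sum_nbij' ZMod.val (fun j => (j : ZMod (2 ^ r))) ?_ ?_ ?_ ?_ ?_
  · intro t _; exact Finset.mem_range.2 (ZMod.val_lt t)
  · intro j _; exact Finset.mem_univ _
  · intro t _; exact ZMod.natCast_zmod_val t
  · intro j hj; exact ZMod.val_cast_of_lt (Finset.mem_range.1 hj)
  · intro t _; rfl

end Restriction

/-! ### Conclusion. -/

theorem two_pow_dvd_levelCount_restricted {a n : ℕ} (hn : 3 ≤ n)
    (Q : MvPolynomial (Fin n) (ZMod (2 ^ (a + 1)))) (hQ : Q.totalDegree ≤ 2) (z : Fin n) (v : ℕ)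
    (hv : v ≤ a + 1) (l g w : ZMod (2 ^ (a + 1))) {σ : ℕ} (hσ : σ ≤ a + 1)
    (k : ZMod (2 ^ (a + 1))) :
    2 ^ (divExp (a + 1) n v - 1 + (a + 1 - v) + σ) ∣
      levelCount (restricted Q z (a + 1 - v) l g w) σ k := by
  have hD := divExp_pos (show 1 ≤ a + 1 by omega) hn v
  obtain ⟨N, hN, hd, hP⟩ := exists_polarForm Q hQ z (a + 1 - v) l g w
  refine two_pow_dvd_levelCount _ _ (fun σ hσ k k' hk => ?_) ?_ hσ k
  · have h1 := two_pow_dvd_card_mul_card_ker N z (by omega) hN hd (by simpa using hn) v σ hv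
      (by omega)
    rw [Fintype.card_fin] at h1
    have h2 := TwoPowCyclotomic.two_pow_dvd_sum_char
      (fun p => 2 ^ σ * restricted Q z (a + 1 - v) l g w p)
      (polarForm (scaledMatrix N z σ (a + 1 - v))) (fun x h => by
        rw [polarForm_scaledMatrix_level]
        linear_combination (2 : ZMod (2 ^ (a + 1))) ^ σ * hP x h) _ h1
    have h3 := TwoPowCyclotomic.dvd_card_sub_card _ _ h2 (2 ^ σ * k)
    rw [← hk] at h3
    rw [show divExp (a + 1) n v - 1 + (a + 1 - v) + σ + 1 =
      divExp (a + 1) n v + (a + 1 - v) + σ by omega]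
    exact h3
  · rw [Fintype.card_fun, ZMod.card, Fintype.card_fin, ← pow_mul]
    exact pow_dvd_pow 2 (divExp_add_le (by omega) hn hv)

theorem corollary1 (r n : ℕ) (hr : 1 ≤ r) (hn : 3 ≤ n)
    (Q : MvPolynomial (Fin n) (ZMod (2 ^ r))) (hQ : Q.totalDegree ≤ 2) (z : Fin n)
    (q v : ℕ) (hq : q ≤ r) (hv : v ≤ r) (k w g l : ℤ) :
    (2 ^ (divExp r n v - 1) ∣
      ∑ j ∈ Finset.range (2 ^ v), solCount Q k z (l + g * 2 ^ (r - v) * j)) ∧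
    (2 ^ (divExp r n v + q - 1) ∣
      ∑ i ∈ Finset.range (2 ^ q), ∑ j ∈ Finset.range (2 ^ v),
        solCount Q (k + w * 2 ^ (r - q) * i) z (l + g * 2 ^ (r - v) * j)) ∧
    (q ≤ v → 2 ^ (divExp r n v - 1) ∣
      ∑ j ∈ Finset.range (2 ^ v),
        solCount Q (k + w * 2 ^ (r - q) * j) z (l + g * 2 ^ (r - v) * j)) := by
  obtain ⟨a, rfl⟩ : ∃ a, r = a + 1 := ⟨r - 1, by omega⟩
  have hD := divExp_pos hr hn v
  have hcount : ∀ k w : ℤ, (2 ^ (a + 1) : ℤ) ∣ w * 2 ^ v →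
      levelCount (restricted Q z (a + 1 - v) l g w) 0 k = 2 ^ (a + 1 - v) *
        ∑ j ∈ Finset.range (2 ^ v), solCount Q (k + w * j) z (l + g * 2 ^ (a + 1 - v) * j) := by
    intro k w hw
    rw [← card_restricted_eq Q z v hv l g k w hw]
    simp only [levelCount, pow_zero, one_mul]
  have hsingle : ∀ k w : ℤ, (2 ^ (a + 1) : ℤ) ∣ w * 2 ^ v →
      2 ^ (divExp (a + 1) n v - 1) ∣ ∑ j ∈ Finset.range (2 ^ v),
        solCount Q (k + w * j) z (l + g * 2 ^ (a + 1 - v) * j) := by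
    intro k w hw
    have h := two_pow_dvd_levelCount_restricted hn Q hQ z v hv l g w (Nat.zero_le _) k
    rw [hcount k w hw, add_zero, add_comm, pow_add] at h
    exact Nat.dvd_of_mul_dvd_mul_left (by positivity) h
  refine ⟨?_, ?_, fun hqv => ?_⟩
  · simpa using hsingle k 0 (by simp)
  · have h := two_pow_dvd_sum_levelCount (restricted Q z (a + 1 - v) l g (0 : ℤ)) _
      (fun σ hσ k => two_pow_dvd_levelCount_restricted hn Q hQ z v hv l g _ hσ k) hq w k
    have h1 : ∀ i : ℕ, levelCount (restricted Q z (a + 1 - v) l g (0 : ℤ)) 0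
        (k + w * 2 ^ (a + 1 - q) * i) = 2 ^ (a + 1 - v) * ∑ j ∈ Finset.range (2 ^ v),
          solCount Q (k + w * 2 ^ (a + 1 - q) * i) z (l + g * 2 ^ (a + 1 - v) * j) := by
      intro i
      have := hcount (k + w * 2 ^ (a + 1 - q) * i) 0 (by simp)
      push_cast at this
      simpa using this
    rw [Finset.sum_congr rfl fun i _ => h1 i, ← Finset.mul_sum,
      show divExp (a + 1) n v - 1 + (a + 1 - v) + q =
        (a + 1 - v) + (divExp (a + 1) n v + q - 1) by omega, pow_add] at h
    exact Nat.dvd_of_mul_dvd_mul_left (by positivity) h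
  -- The twist absorbs the moving value of `Q`; `q ≤ v` is what makes it periodic modulo `2^v`.
  · refine hsingle k (w * 2 ^ (a + 1 - q)) ?_
    rw [mul_assoc, ← pow_add]
    exact (pow_dvd_pow 2 (by omega)).mul_left w
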